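/- Let $r>1$, $\alpha>1$, and let $u$ be a complex-valued function that is analytic at every point of the cut annulus $\{z\in\mathbb C : r^{-1}\le |z|\le r\}\setminus[r^{-1},r]$. Suppose there are constants $u(1),\,u(e^{2\pi i}),\,C_3,\,C_4\in\mathbb C$ such that $$u(e^{it})=u(1)+C_3\,t^{\alpha-1}+o(|t|^{\alpha-1})\quad\text{as } t\to 0,\ \operatorname{Re}t>0,$$ $$u(e^{it})=u(e^{2\pi i})+C_4\,(2\pi-t)^{\alpha-1}+o(|2\pi-t|^{\alpha-1})\quad\text{as } t\to 2\pi,\ \operatorname{Re}t<2\pi,$$ where $t$ is complex and powers are principal. (Thus $u(1)$ and $u(e^{2\pi i})$ denote the one-sided limits of $u$ at the point $1$ from the upper and from the lower side of the cut; they may differ.) Put $$I(u)=\int_0^{2\pi}u(e^{it})\,dt,\qquad T_n(u)=\frac{2\pi}{n}\left(\tfrac12u(1)+\sum_{k=1}^{n-1}u(e^{2\pi ik/n})+\tfrac12u(e^{2\pi i})\right).$$ Then $t\mapsto u(e^{it})$ is integrable on $[0,2\pi]$ and $$T_n(u)-I(u)=2\,(C_3+C_4)\cos\left(\tfrac{\pi}{2}\alpha\right)\Gamma(\alpha)\,\zeta(\alpha)\,n^{-\alpha}+o(n^{-\alpha}),\qquad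 n\to\infty .$$ -/

import Mathlib

open scoped Real Topology Asymptotics

noncomputable section

/-- The closed annulus `r⁻¹ ≤ |z| ≤ r`, cut along the real interval `[r⁻¹, r]`. -/
def cutAnnulus (r : ℝ) : Set ℂ :=
  {z : ℂ | r⁻¹ ≤ ‖z‖ ∧ ‖z‖ ≤ r} \ ((fun x : ℝ => (x : ℂ)) '' Set.Icc r⁻¹ r)

/-- `I(u) = ∫₀^{2π} u(e^{it}) dt`. -/
def circleIntegralI (u : ℂ → ℂ) : ℂ :=
  ∫ t in (0 : ℝ)..(2 * π), u (Complex.exp (Complex.I * (t : ℂ)))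

/-- The non-periodic trapezoidal rule `(2π/n) ∑''_{k=0}^{n} u(e^{2πik/n})`, first and last terms
halved. The function `u` is two-valued at the point `1` of the cut: `uStart` is the value used at
`k = 0` (that is, `u(1)`) and `uEnd` the one used at `k = n` (that is, `u(e^{2πi})`). -/
def trapezoidalRule (u : ℂ → ℂ) (uStart uEnd : ℂ) (n : ℕ) : ℂ :=
  (2 * (π : ℂ) / (n : ℂ)) *
    (uStart / 2
      + ∑ k ∈ Finset.Ico 1 n, u (Complex.exp (2 * (π : ℂ) * Complex.I * (k : ℂ) / (n : ℂ)))
      + uEnd / 2)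

end

/-! Symmetrise: with `v t = u (e^{it})`, put `w t = v t + v (2π - t)`. This doubles both the
trapezoidal sum and the integral, makes the two end values agree (both are `uStart + uEnd`), and
gives both ends the same singular term with coefficient `C = C₃ + C₄`.

A continuous periodic function with summable Fourier coefficients equals its Fourier series, and
sampling at `n` equispaced nodes keeps only the frequencies divisible by `n`. Hence the quadrature
error of `u` is `∑_{j ≥ 1} c (j n)`, where `c m = ∫ w e^{imt}` (`hasSum_trapezoidal_aliasing`).

To estimate `c m`, push the contour up to height `δ`. The horizontal side contributes `O(e^{-δm})`.
By symmetry the vertical sides combine into `i ∫ (w (iy) - w (-iy)) e^{-my} dy`, where the constant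
cancels and the jump of the power gives `2 C cos(πα/2) y^{α-1}`. As in Watson's lemma, `c m = 2 C
cos(πα/2) Γ(α) m^{-α} + o(m^{-α})` (`fourierIntegral_sub_rpow_isLittleO`). Summing over the
multiples of `n` produces `ζ(α) n^{-α}` (`tsum_multiples_sub_zeta_isLittleO`); `α > 1` makes all
these series converge. -/

/-! ### Aliasing: the trapezoidal error as a sum of Fourier coefficients. -/

open Complex in
theorem integral_mul_cexp_neg_of_symm {W : ℝ → ℂ}
    (hsym : ∀ t ∈ Set.Icc 0 (2 * π), W (2 * π - t) = W t) (m : ℤ) :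
    ∫ t in (0 : ℝ)..(2 * π), W t * cexp (I * (-m : ℤ) * t) =
      ∫ t in (0 : ℝ)..(2 * π), W t * cexp (I * m * t) := by
  have h := intervalIntegral.integral_comp_sub_left
    (fun t : ℝ => W t * cexp (I * m * t)) (a := 0) (b := 2 * π) (2 * π)
  simp only [sub_self, sub_zero] at h
  rw [← h]
  refine intervalIntegral.integral_congr fun t ht => ?_
  rw [Set.uIcc_of_le (by positivity)] at ht
  rw [hsym t ht]
  congr 1
  rw [Complex.exp_eq_exp_iff_exists_int]
  exact ⟨-m, by push_cast; ring⟩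

theorem sum_fourier_equispaced [Fact (0 < 2 * π)] {n : ℕ} (hn : 0 < n) (m : ℤ) :
    ∑ k ∈ Finset.range n, fourier m (((2 * π * k / n : ℝ)) : AddCircle (2 * π)) =
      if (n : ℤ) ∣ m then (n : ℂ) else 0 := by
  have hn' : (n : ℂ) ≠ 0 := by exact_mod_cast hn.ne'
  have hpi : (π : ℂ) ≠ 0 := by exact_mod_cast Real.pi_ne_zero
  set q : ℂ := Complex.exp (2 * π * Complex.I * m / n) with hq
  have hterm : ∀ k : ℕ, fourier m (((2 * π * k / n : ℝ)) : AddCircle (2 * π)) = q ^ k := by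
    intro k
    rw [fourier_coe_apply, hq, ← Complex.exp_nat_mul]
    congr 1
    push_cast
    field_simp
  simp only [hterm]
  have hqn : q ^ n = 1 := by
    rw [hq, ← Complex.exp_nat_mul, Complex.exp_eq_one_iff]
    exact ⟨m, by field_simp⟩
  have hq1 : q = 1 ↔ (n : ℤ) ∣ m := by
    rw [hq, Complex.exp_eq_one_iff]
    constructor
    · rintro ⟨j, hj⟩
      refine ⟨j, ?_⟩
      have h2 : (2 * π * Complex.I : ℂ) ≠ 0 := Complex.two_pi_I_ne_zero
      have : (m : ℂ) = n * j := by
        field_simp at hj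
        exact hj
      exact_mod_cast this
    · rintro ⟨j, rfl⟩
      exact ⟨j, by push_cast; field_simp⟩
  split_ifs with h
  · simp [hq1.2 h]
  · have hne : q ≠ 1 := fun h' => h (hq1.1 h')
    rw [geom_sum_eq hne, hqn]; simp

open Complex in
theorem hasSum_trapezoidal_aliasing {W : ℝ → ℂ} (hc : ContinuousOn W (Set.Icc 0 (2 * π)))
    (hsym : ∀ t ∈ Set.Icc 0 (2 * π), W (2 * π - t) = W t)
    (hs : Summable fun m : ℕ => ∫ t in (0 : ℝ)..(2 * π), W t * cexp (I * m * t))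
    {n : ℕ} (hn : 0 < n) :
    HasSum (fun j : ℕ => 2 * ∫ t in (0 : ℝ)..(2 * π), W t * cexp (I * ((j + 1) * n : ℕ) * t))
      ((2 * π / n : ℂ) * ∑ k ∈ Finset.range n, W (2 * π * k / n)
        - ∫ t in (0 : ℝ)..(2 * π), W t) := by
  have hT : Fact (0 < 2 * π) := ⟨by positivity⟩
  have hn' : (n : ℂ) ≠ 0 := by exact_mod_cast hn.ne'
  have hpi : (π : ℂ) ≠ 0 := by exact_mod_cast Real.pi_ne_zero
  set c : ℤ → ℂ := fun m => ∫ t in (0 : ℝ)..(2 * π), W t * cexp (I * m * t) with hcdef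
  have hcneg : ∀ m, c (-m) = c m := integral_mul_cexp_neg_of_symm hsym
  have h0 : W 0 = W (2 * π) := by
    have := hsym 0 ⟨le_rfl, by positivity⟩
    simpa using this.symm
  let f : C(AddCircle (2 * π), ℂ) :=
    ⟨AddCircle.liftIco (2 * π) 0 W, AddCircle.liftIco_zero_continuous h0 hc⟩
  have hf : ∀ x ∈ Set.Ico 0 (2 * π), f (x : AddCircle (2 * π)) = W x := fun x hx =>
    AddCircle.liftIco_zero_coe_apply hx
  have hcoef : ∀ m, fourierCoeff f m = (1 / (2 * π) : ℂ) * c m := by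
    intro m
    -- `fourierCoeff` integrates against `e^{-imt}`, `c` against `e^{imt}`; evenness of `c`
    -- reconciles them.
    rw [← hcneg m, fourierCoeff_eq_intervalIntegral _ _ 0, hcdef, zero_add, Complex.real_smul]
    push_cast
    congr 1
    refine intervalIntegral.integral_congr_Ioo_of_le (by positivity) fun x hx => ?_
    simp only [smul_eq_mul]
    rw [hf x ⟨hx.1.le, hx.2⟩, fourier_coe_apply, mul_comm]
    congr 2
    push_cast
    field_simp
  have hsZ : Summable c := by
    refine Summable.of_nat_of_neg (f := c) ?_ ?_
    · simpa [hcdef] using hs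
    · simp only [hcneg]
      simpa [hcdef] using hs
  have hfs : Summable (fourierCoeff f) := by
    rw [show fourierCoeff f = fun m => (1 / (2 * π) : ℂ) * c m from funext hcoef]
    exact hsZ.mul_left _
  have h1 : HasSum (fun m : ℤ => ((1 / (2 * π) : ℂ) * c m) *
      (if (n : ℤ) ∣ m then (n : ℂ) else 0)) (∑ k ∈ Finset.range n, W (2 * π * k / n)) := by
    have := hasSum_sum (s := Finset.range n) fun k _ =>
      has_pointwise_sum_fourier_series_of_summable hfs ((2 * π * k / n : ℝ) : AddCircle (2 * π))
    simp only [smul_eq_mul, ← Finset.mul_sum, sum_fourier_equispaced hn, hcoef] at this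
    convert! this using 1
    refine Finset.sum_congr rfl fun k hk => (hf _ ⟨by positivity, ?_⟩).symm
    have hk' : (k : ℝ) < n := by exact_mod_cast Finset.mem_range.1 hk
    rw [div_lt_iff₀ (by positivity)]
    exact mul_lt_mul_of_pos_left hk' (by positivity)
  have hinj : Function.Injective (fun j : ℤ => j * n) := by
    intro a b hab
    exact mul_right_cancel₀ (by exact_mod_cast hn.ne') hab
  have h2 := (hinj.hasSum_iff (f := fun m : ℤ => ((1 / (2 * π) : ℂ) * c m) *
      (if (n : ℤ) ∣ m then (n : ℂ) else 0)) (by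
    intro x hx
    rw [if_neg, mul_zero]
    rintro ⟨j, rfl⟩
    exact hx ⟨j, mul_comm _ _⟩)).2 h1
  have h3 : HasSum (fun j : ℤ => c (j * n))
      ((2 * π / n : ℂ) * ∑ k ∈ Finset.range n, W (2 * π * k / n)) := by
    convert! h2.mul_left (2 * π / n : ℂ) using 1
    funext j
    simp only [Function.comp, dvd_mul_left, if_true]
    field_simp
  have h4 := h3.nat_add_neg
  -- Pairing `±j` adds `c 0` to the sum, and the discarded `j = 0` term is `2 * c 0`; the net effect
  -- is to subtract `c 0 = ∫ W`.
  rw [← hasSum_nat_add_iff' 1] at h4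
  convert! h4 using 1
  · funext j
    rw [neg_mul, hcneg, ← two_mul]
    simp [hcdef]
  · simp [hcdef]

/-! ### Summation over multiples and the zeta value. -/

theorem summable_of_sub_rpow_isLittleO {c : ℕ → ℂ} {D : ℂ} {α : ℝ} (hα : 1 < α)
    (h : (fun m : ℕ => c m - D * (((m : ℝ) ^ (-α) : ℝ) : ℂ)) =o[Filter.atTop]
      fun m : ℕ => (m : ℝ) ^ (-α)) : Summable c := by
  refine summable_of_isBigO_nat (g := fun m : ℕ => (m : ℝ) ^ (-α))
    (Real.summable_nat_rpow.2 (by linarith)) ?_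
  have h2 : (fun m : ℕ => D * (((m : ℝ) ^ (-α) : ℝ) : ℂ)) =O[Filter.atTop]
      fun m : ℕ => (m : ℝ) ^ (-α) :=
    Asymptotics.IsBigO.const_mul_left
      (Asymptotics.IsBigO.of_bound 1 (by simp)) D
  simpa using h.isBigO.add h2

/-- Every multiple `(j + 1) n` is at least `n`, so a single threshold controls the error for all `j`
at once, and the factors `(j + 1)^{-α}` are summable. -/
theorem tsum_multiples_sub_zeta_isLittleO {c : ℕ → ℂ} {D : ℂ} {α : ℝ} (hα : 1 < α)
    (h : (fun m : ℕ => c m - D * (((m : ℝ) ^ (-α) : ℝ) : ℂ)) =o[Filter.atTop]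
      fun m : ℕ => (m : ℝ) ^ (-α)) :
    (fun n : ℕ => ∑' j : ℕ, c ((j + 1) * n)
        - D * riemannZeta (α : ℂ) * (((n : ℝ) ^ (-α) : ℝ) : ℂ)) =o[Filter.atTop]
      fun n : ℕ => (n : ℝ) ^ (-α) := by
  have hsum : Summable fun j : ℕ => (((j + 1 : ℕ) : ℝ)) ^ (-α) :=
    (summable_nat_add_iff 1).2 (Real.summable_nat_rpow.2 (by linarith))
  have hzeta : HasSum (fun j : ℕ => (((((j + 1 : ℕ) : ℝ)) ^ (-α) : ℝ) : ℂ))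
      (riemannZeta (α : ℂ)) := by
    have h1 : Summable fun j : ℕ => (((((j + 1 : ℕ) : ℝ)) ^ (-α) : ℝ) : ℂ) := by
      exact_mod_cast hsum
    convert! h1.hasSum using 1
    rw [zeta_eq_tsum_one_div_nat_add_one_cpow (by simpa using hα)]
    refine tsum_congr fun j => ?_
    rw [Complex.ofReal_cpow (by positivity)]
    push_cast
    rw [Complex.cpow_neg, one_div]
  set Z : ℝ := ∑' j : ℕ, (((j + 1 : ℕ) : ℝ)) ^ (-α)
  have hZ : 0 ≤ Z := tsum_nonneg fun j => by positivity
  rw [Asymptotics.isLittleO_iff] at h ⊢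
  intro ε hε
  obtain ⟨M, hM⟩ := Filter.eventually_atTop.1 (h (show 0 < ε / (Z + 1) by positivity))
  filter_upwards [Filter.eventually_ge_atTop M, Filter.eventually_gt_atTop 0] with n hn hn0
  have hsplit : ∀ j : ℕ, (((j + 1) * n : ℕ) : ℝ) ^ (-α) =
      ((j + 1 : ℕ) : ℝ) ^ (-α) * (n : ℝ) ^ (-α) := fun j => by
    rw [Nat.cast_mul, Real.mul_rpow (by positivity) (by positivity)]
  have hb : ∀ j : ℕ, ‖c ((j + 1) * n) - D * ((((j + 1) * n : ℕ) : ℝ) ^ (-α) : ℝ)‖ ≤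
      (ε / (Z + 1) * (n : ℝ) ^ (-α)) * ((j + 1 : ℕ) : ℝ) ^ (-α) := fun j => by
    refine (hM _ (hn.trans (Nat.le_mul_of_pos_left _ (by omega)))).trans_eq ?_
    rw [Real.norm_of_nonneg (by positivity), hsplit]
    ring
  have hs1 := Summable.of_norm_bounded (hsum.mul_left _) hb
  have hs2 : HasSum (fun j : ℕ => D * (((((j + 1) * n : ℕ) : ℝ) ^ (-α) : ℝ) : ℂ))
      (D * riemannZeta (α : ℂ) * (((n : ℝ) ^ (-α) : ℝ) : ℂ)) := by
    convert! (hzeta.mul_left D).mul_right ((((n : ℝ) ^ (-α) : ℝ) : ℂ)) using 1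
    funext j
    rw [hsplit, Complex.ofReal_mul, mul_assoc]
  have hs3 : Summable fun j : ℕ => c ((j + 1) * n) := by
    simpa using hs1.add hs2.summable
  rw [← hs2.tsum_eq, ← hs3.tsum_sub hs2.summable]
  refine (tsum_of_norm_bounded (hsum.hasSum.mul_left _) hb).trans ?_
  rw [Real.norm_of_nonneg (by positivity)]
  calc ε / (Z + 1) * (n : ℝ) ^ (-α) * Z = (ε * (n : ℝ) ^ (-α)) * (Z / (Z + 1)) := by ring
    _ ≤ (ε * (n : ℝ) ^ (-α)) * 1 := by
      gcongr
      rw [div_le_one (by positivity)]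
      linarith
    _ = _ := mul_one _

/-! ### Asymptotics of the Fourier integrals by contour deformation. -/

open Complex in
/-- Cauchy's theorem on the rectangle `[ε, 2π - ε] × [0, δ]`, with the right side folded back to the
left one by the symmetry of `w`. -/
theorem integral_mul_cexp_eq_contour {w : ℂ → ℂ} {d ε δ : ℝ} (hε : 0 < ε) (hεπ : ε < π)
    (hδ : 0 < δ) (hδd : δ < d)
    (hw : DifferentiableOn ℂ w {t | 0 < t.re ∧ t.re < 2 * π ∧ |t.im| < d})
    (hsym : ∀ t, w (2 * π - t) = w t) (m : ℕ) :
    ∫ x in ε..(2 * π - ε), w x * cexp (I * m * x) =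
      (∫ x in ε..(2 * π - ε), w (x + δ * I) * cexp (I * m * (x + δ * I))) +
      I * ∫ y in (0 : ℝ)..δ, (w (ε + y * I) * cexp (I * m * (ε + y * I))
        - w (ε - y * I) * cexp (I * m * (-ε + y * I))) := by
  have hmem : ∀ x y : ℝ, 0 < x → x < 2 * π → |y| < d →
      (x + y * I : ℂ) ∈ {t : ℂ | 0 < t.re ∧ t.re < 2 * π ∧ |t.im| < d} := by
    intro x y h1 h2 h3
    simpa using ⟨h1, h2, h3⟩
  have hS : IsOpen {t : ℂ | 0 < t.re ∧ t.re < 2 * π ∧ |t.im| < d} :=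
    (isOpen_lt continuous_const continuous_re).inter
      ((isOpen_lt continuous_re continuous_const).inter
        (isOpen_lt continuous_im.abs continuous_const))
  have hC := integral_boundary_rect_eq_zero_of_differentiableOn
    (fun t => w t * cexp (I * m * t)) (ε : ℂ) ((2 * π - ε : ℝ) + δ * I) (by
      refine DifferentiableOn.mul (hw.mono fun t ht => ?_) (by fun_prop)
      rw [mem_reProdIm] at ht
      simp only [ofReal_re, ofReal_im, add_re, add_im, mul_re, mul_im, I_re, I_im] at ht
      rw [Set.uIcc_of_le (by linarith), Set.uIcc_of_le (by linarith)] at ht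
      obtain ⟨⟨h1, h2⟩, h3, h4⟩ := ht
      refine ⟨by linarith, by linarith, ?_⟩
      rw [abs_lt]
      constructor <;> linarith)
  simp only [ofReal_re, ofReal_im, add_re, add_im, mul_re, mul_im, I_re, I_im, mul_zero, zero_mul,
    mul_one, add_zero, zero_add, smul_eq_mul, ofReal_zero, sub_self] at hC
  have hcont : ∀ x : ℝ, 0 < x → x < 2 * π → ContinuousOn (fun y : ℝ => w (x + y * I))
      (Set.uIcc 0 δ) := by
    intro x h1 h2
    refine hw.continuousOn.comp (by fun_prop) fun y hy => hmem x y h1 h2 ?_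
    rw [Set.uIcc_of_le hδ.le] at hy
    rw [abs_of_nonneg hy.1]
    linarith [hy.2]
  -- Reflection sends `2π - ε + iy` to `ε - iy`, while the exponential is `2π`-periodic since `m` is
  -- an integer.
  have e1 : ∫ y in (0 : ℝ)..δ, w ((2 * π - ε : ℝ) + y * I) * cexp (I * m * ((2 * π - ε : ℝ) + y * I))
      = ∫ y in (0 : ℝ)..δ, w (ε - y * I) * cexp (I * m * (-ε + y * I)) := by
    refine intervalIntegral.integral_congr fun y _ => ?_
    congr 1
    · rw [← hsym]
      congr 1
      push_cast
      ring
    · rw [Complex.exp_eq_exp_iff_exists_int]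
      exact ⟨m, by push_cast; ring⟩
  have i1 : IntervalIntegrable (fun y : ℝ => w (ε + y * I) * cexp (I * m * (ε + y * I)))
      MeasureTheory.volume 0 δ :=
    ((hcont ε hε (by linarith)).mul (by fun_prop)).intervalIntegrable
  have i2 : IntervalIntegrable (fun y : ℝ => w (ε - y * I) * cexp (I * m * (-ε + y * I)))
      MeasureTheory.volume 0 δ := by
    refine ContinuousOn.intervalIntegrable (ContinuousOn.mul ?_ (by fun_prop))
    refine (hcont (2 * π - ε) (by linarith) (by linarith)).congr fun y _ => ?_
    rw [← hsym]
    congr 1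
    push_cast
    ring
  rw [intervalIntegral.integral_sub i1 i2, ← e1]
  linear_combination hC

/-- The difference is the tail beyond `δ`, where `e^{-my} = e^{-(m-1)y} e^{-y} ≤ e^{δ - δm} e^{-y}`
because `m ≥ 1`. -/
theorem integral_rpow_mul_exp_neg_truncated {α δ : ℝ} (hα : 1 < α) (hδ : 0 < δ) {m : ℕ}
    (hm : 1 ≤ m) :
    0 ≤ Real.Gamma α * (m : ℝ) ^ (-α)
        - ∫ y in (0 : ℝ)..δ, y ^ (α - 1) * Real.exp (-(m * y)) ∧
    Real.Gamma α * (m : ℝ) ^ (-α) - ∫ y in (0 : ℝ)..δ, y ^ (α - 1) * Real.exp (-(m * y)) ≤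
      Real.exp δ * Real.Gamma α * Real.exp (-(δ * m)) := by
  have hm0 : (0 : ℝ) < m := by exact_mod_cast hm
  have hm1 : (1 : ℝ) ≤ m := by exact_mod_cast hm
  have hint : ∀ b : ℝ, 0 < b → MeasureTheory.IntegrableOn
      (fun y : ℝ => y ^ (α - 1) * Real.exp (-(b * y))) (Set.Ioi 0) := by
    intro b hb
    have := integrableOn_rpow_mul_exp_neg_mul_rpow (s := α - 1) (p := 1) (by linarith)
      one_pos hb
    simpa using this
  have htot := Real.integral_rpow_mul_exp_neg_mul_Ioi (a := α) (by linarith) hm0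
  rw [one_div, Real.inv_rpow hm0.le, ← Real.rpow_neg hm0.le, mul_comm] at htot
  have hsplit := intervalIntegral.integral_interval_add_Ioi (a := 0) (b := δ) (hint m hm0)
    ((hint m hm0).mono_set (Set.Ioi_subset_Ioi hδ.le))
  rw [htot] at hsplit
  have heq : Real.Gamma α * (m : ℝ) ^ (-α)
        - ∫ y in (0 : ℝ)..δ, y ^ (α - 1) * Real.exp (-(m * y)) =
      ∫ y in Set.Ioi δ, y ^ (α - 1) * Real.exp (-(m * y)) := by
    linarith
  rw [heq]
  have hnn : ∀ b : ℝ, ∀ y ∈ Set.Ioi (0 : ℝ), 0 ≤ y ^ (α - 1) * Real.exp (-(b * y)) :=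
    fun b y hy => mul_nonneg (Real.rpow_nonneg (le_of_lt hy) _) (Real.exp_pos _).le
  refine ⟨MeasureTheory.setIntegral_nonneg measurableSet_Ioi fun y hy =>
    hnn _ y (hδ.trans hy), ?_⟩
  have h1 : ∫ y in Set.Ioi (0 : ℝ), y ^ (α - 1) * Real.exp (-(1 * y)) = Real.Gamma α := by
    rw [Real.integral_rpow_mul_exp_neg_mul_Ioi (by linarith) one_pos]
    simp
  calc ∫ y in Set.Ioi δ, y ^ (α - 1) * Real.exp (-(m * y))
      ≤ ∫ y in Set.Ioi δ, (Real.exp δ * Real.exp (-(δ * m))) *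
          (y ^ (α - 1) * Real.exp (-(1 * y))) := by
        refine MeasureTheory.setIntegral_mono_on
          ((hint m hm0).mono_set (Set.Ioi_subset_Ioi hδ.le))
          (((hint 1 one_pos).mono_set (Set.Ioi_subset_Ioi hδ.le)).const_mul _)
          measurableSet_Ioi fun y hy => ?_
        have hy' : δ < y := hy
        rw [mul_left_comm, ← Real.exp_add, ← Real.exp_add]
        refine mul_le_mul_of_nonneg_left (Real.exp_le_exp.2 ?_) (Real.rpow_nonneg (by linarith) _)
        nlinarith
    _ = (Real.exp δ * Real.exp (-(δ * m))) *
          ∫ y in Set.Ioi δ, y ^ (α - 1) * Real.exp (-(1 * y)) := by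
        rw [MeasureTheory.integral_const_mul]
    _ ≤ (Real.exp δ * Real.exp (-(δ * m))) * Real.Gamma α := by
        refine mul_le_mul_of_nonneg_left ?_ (by positivity)
        rw [← h1]
        exact MeasureTheory.setIntegral_mono_set (hint 1 one_pos)
          ((MeasureTheory.ae_restrict_iff' measurableSet_Ioi).2 (.of_forall (hnn 1)))
          (Set.Ioi_subset_Ioi hδ.le).eventuallyLE
    _ = _ := by ring

open Complex in
-- Source of the cosine: principal powers give `i^{α-1} = -i e^{iπα/2}` and `(-i)^{α-1} = i
-- e^{-iπα/2}`.
theorem I_mul_cpow_I_mul_sub_cpow_neg_I_mul {y : ℝ} (hy : 0 ≤ y) {α : ℝ} (hα : 1 < α) :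
    I * ((y * I : ℂ) ^ ((α - 1 : ℝ) : ℂ) - (-(y * I) : ℂ) ^ ((α - 1 : ℝ) : ℂ)) =
      2 * (Real.cos (π / 2 * α) : ℂ) * ((y ^ (α - 1) : ℝ) : ℂ) := by
  have hne : ((α - 1 : ℝ) : ℂ) ≠ 0 := by exact_mod_cast (by linarith : α - 1 ≠ 0)
  rcases hy.eq_or_lt with rfl | hy'
  · rw [ofReal_zero, zero_mul, neg_zero, Complex.zero_cpow hne,
      Real.zero_rpow (by linarith : α - 1 ≠ 0)]
    simp
  have hmul : ∀ z : ℂ, z ≠ 0 → (y * z : ℂ) ^ ((α - 1 : ℝ) : ℂ) =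
      ((y ^ (α - 1) : ℝ) : ℂ) * cexp (log z * (α - 1 : ℝ)) := by
    intro z hz
    have hyC : (y : ℂ) ≠ 0 := ofReal_ne_zero.2 hy'.ne'
    rw [ofReal_cpow hy, cpow_def_of_ne_zero (mul_ne_zero hyC hz), cpow_def_of_ne_zero hyC,
      log_ofReal_mul hy' hz, ofReal_log hy, add_mul, Complex.exp_add]
  rw [show -(y * I : ℂ) = y * (-I) by ring, hmul I I_ne_zero, hmul (-I) (neg_ne_zero.2 I_ne_zero),
    log_I, log_neg_I]
  have h1 : cexp (π / 2 * I * (α - 1 : ℝ)) = cexp (π / 2 * α * I) * (-I) := by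
    rw [← exp_neg_pi_div_two_mul_I, ← Complex.exp_add]
    congr 1; push_cast; ring
  have h2 : cexp (-(π / 2) * I * (α - 1 : ℝ)) = cexp (-(π / 2 * α) * I) * I := by
    nth_rewrite 3 [← exp_pi_div_two_mul_I]
    rw [← Complex.exp_add]
    congr 1; push_cast; ring
  rw [h1, h2, ofReal_cos, Complex.cos]
  push_cast
  linear_combination (-((y ^ (α - 1) : ℝ) : ℂ) *
    (cexp (π / 2 * α * I) + cexp (-(π / 2 * α) * I))) * I_sq

theorem tendsto_integral_shrinking_endpoints {f : ℝ → ℂ} {a b : ℝ} (hab : a < b)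
    (hf : IntervalIntegrable f MeasureTheory.volume a b) :
    Filter.Tendsto (fun ε => ∫ x in (a + ε)..(b - ε), f x) (𝓝[>] 0) (𝓝 (∫ x in a..b, f x)) := by
  have hF : ContinuousOn (fun x => ∫ t in a..x, f t) (Set.Icc a b) := by
    have := intervalIntegral.continuousOn_primitive_interval (μ := MeasureTheory.volume)
      (f := f) (a := a) (b := b)
      (by rw [Set.uIcc_of_le hab.le]; exact (intervalIntegrable_iff_integrableOn_Icc_of_le hab.le).1 hf)
    rwa [Set.uIcc_of_le hab.le] at this
  have hev : ∀ᶠ ε in 𝓝[>] (0 : ℝ), 0 < ε ∧ ε < b - a := by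
    filter_upwards [Ioo_mem_nhdsGT (sub_pos.2 hab)] with ε h using h
  have ha : Filter.Tendsto (fun ε : ℝ => a + ε) (𝓝[>] 0) (𝓝[Set.Icc a b] a) := by
    refine tendsto_nhdsWithin_iff.2 ⟨?_, ?_⟩
    · exact ((continuous_const.add continuous_id).tendsto' 0 a (by simp)).mono_left
        nhdsWithin_le_nhds
    · filter_upwards [hev] with ε h
      constructor <;> linarith
  have hb : Filter.Tendsto (fun ε : ℝ => b - ε) (𝓝[>] 0) (𝓝[Set.Icc a b] b) := by
    refine tendsto_nhdsWithin_iff.2 ⟨?_, ?_⟩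
    · exact ((continuous_const.sub continuous_id).tendsto' 0 b (by simp)).mono_left
        nhdsWithin_le_nhds
    · filter_upwards [hev] with ε h
      constructor <;> linarith
  have h := ((hF b ⟨hab.le, le_rfl⟩).tendsto.comp hb).sub
    ((hF a ⟨le_rfl, hab.le⟩).tendsto.comp ha)
  simp only [intervalIntegral.integral_same, sub_zero] at h
  refine h.congr' ?_
  filter_upwards [hev] with ε hε
  refine intervalIntegral.integral_interval_sub_left ?_ ?_ <;>
    refine hf.mono_set ?_ <;> rw [Set.uIcc_of_le (by linarith), Set.uIcc_of_le hab.le] <;>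
    exact Set.Icc_subset_Icc_right (by linarith)

open Complex in
-- Dominated convergence. At `ε = 0` both exponentials become `e^{-my}`, so `A` cancels and only the
-- jump of the power remains.
theorem tendsto_integral_vertical_main_term (A C : ℂ) {α δ : ℝ} (hα : 1 < α) (hδ : 0 < δ) (m : ℕ) :
    Filter.Tendsto (fun ε : ℝ => I * ∫ y in (0 : ℝ)..δ,
      ((A + C * (ε + y * I : ℂ) ^ ((α - 1 : ℝ) : ℂ)) * cexp (I * m * (ε + y * I))
        - (A + C * (ε - y * I : ℂ) ^ ((α - 1 : ℝ) : ℂ)) * cexp (I * m * (-ε + y * I))))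
      (𝓝[>] 0) (𝓝 (2 * C * (Real.cos (π / 2 * α) : ℂ) *
        (∫ y in (0 : ℝ)..δ, y ^ (α - 1) * Real.exp (-(m * y)) : ℝ))) := by
  have hs : 0 < (((α - 1 : ℝ) : ℂ)).re := by simpa using hα
  have hlim : 2 * C * (Real.cos (π / 2 * α) : ℂ) *
        (∫ y in (0 : ℝ)..δ, y ^ (α - 1) * Real.exp (-(m * y)) : ℝ) =
      I * ∫ y in (0 : ℝ)..δ,
      ((A + C * ((0 : ℝ) + y * I : ℂ) ^ ((α - 1 : ℝ) : ℂ)) * cexp (I * m * ((0 : ℝ) + y * I))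
        - (A + C * ((0 : ℝ) - y * I : ℂ) ^ ((α - 1 : ℝ) : ℂ))
          * cexp (I * m * (-(0 : ℝ) + y * I))) := by
    rw [← intervalIntegral.integral_ofReal, ← intervalIntegral.integral_const_mul,
      ← intervalIntegral.integral_const_mul]
    refine intervalIntegral.integral_congr fun y hy => ?_
    rw [Set.uIcc_of_le hδ.le] at hy
    have h := I_mul_cpow_I_mul_sub_cpow_neg_I_mul hy.1 hα
    have e : cexp (I * m * (y * I)) = ((Real.exp (-(m * y)) : ℝ) : ℂ) := by
      rw [ofReal_exp]
      congr 1
      push_cast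
      linear_combination (m * y : ℂ) * I_sq
    simp only [ofReal_zero, zero_add, zero_sub, neg_zero, e]
    rw [ofReal_mul]
    linear_combination (-C * ((Real.exp (-(m * y)) : ℝ) : ℂ)) * h
  rw [hlim]
  refine Filter.Tendsto.const_mul I ?_
  have hnorm : ∀ (z : ℂ), ‖z‖ ≤ 1 + δ → ‖A + C * z ^ ((α - 1 : ℝ) : ℂ)‖ ≤
      ‖A‖ + ‖C‖ * (1 + δ) ^ (α - 1) := by
    intro z hz
    refine (norm_add_le _ _).trans ?_
    rw [norm_mul, norm_cpow_real]
    gcongr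
  have hexp : ∀ x y : ℝ, 0 ≤ y → ‖cexp (I * m * (x + y * I))‖ ≤ 1 := by
    intro x y hy
    rw [norm_exp]
    simp
    positivity
  have hz : ∀ ε y : ℝ, 0 < ε → ε < 1 → 0 ≤ y → y ≤ δ →
      ‖(ε + y * I : ℂ)‖ ≤ 1 + δ ∧ ‖(ε - y * I : ℂ)‖ ≤ 1 + δ := by
    intro ε y h1 h2 h3 h4
    have a1 : ‖(ε : ℂ)‖ ≤ 1 := by rw [norm_real, Real.norm_of_nonneg h1.le]; exact h2.le
    have a2 : ‖(y * I : ℂ)‖ ≤ δ := by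
      rw [norm_mul, norm_I, mul_one, norm_real, Real.norm_of_nonneg h3]; exact h4
    exact ⟨(norm_add_le _ _).trans (add_le_add a1 a2), (norm_sub_le _ _).trans (add_le_add a1 a2)⟩
  refine intervalIntegral.tendsto_integral_filter_of_dominated_convergence
    (fun _ => 2 * (‖A‖ + ‖C‖ * (1 + δ) ^ (α - 1))) ?_ ?_ (by simp) ?_
  · filter_upwards [self_mem_nhdsWithin] with ε hε
    have hε' : 0 < ε := hε
    refine Continuous.aestronglyMeasurable ?_
    have c1 : Continuous fun y : ℝ => (ε + y * I : ℂ) ^ ((α - 1 : ℝ) : ℂ) :=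
      Continuous.cpow (by fun_prop) continuous_const fun y => Or.inl (by simpa using hε')
    have c2 : Continuous fun y : ℝ => (ε - y * I : ℂ) ^ ((α - 1 : ℝ) : ℂ) :=
      Continuous.cpow (by fun_prop) continuous_const fun y => Or.inl (by simpa using hε')
    fun_prop
  · filter_upwards [Ioo_mem_nhdsGT one_pos] with ε hε
    refine Filter.Eventually.of_forall fun y hy => ?_
    rw [Set.uIoc_of_le hδ.le] at hy
    obtain ⟨b1, b2⟩ := hz ε y hε.1 hε.2 hy.1.le hy.2
    have b3 := hexp (-ε) y hy.1.le
    rw [ofReal_neg] at b3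
    refine (norm_sub_le _ _).trans ?_
    rw [norm_mul, norm_mul, two_mul]
    have hnn : 0 ≤ ‖A‖ + ‖C‖ * (1 + δ) ^ (α - 1) := by positivity
    exact add_le_add
      ((mul_le_mul (hnorm _ b1) (hexp ε y hy.1.le) (norm_nonneg _) hnn).trans_eq (mul_one _))
      ((mul_le_mul (hnorm _ b2) b3 (norm_nonneg _) hnn).trans_eq (mul_one _))
  · refine Filter.Eventually.of_forall fun y hy => ?_
    refine (ContinuousAt.tendsto (x := (0 : ℝ)) (f := fun ε : ℝ =>
      ((A + C * (ε + y * I : ℂ) ^ ((α - 1 : ℝ) : ℂ)) * cexp (I * m * (ε + y * I))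
        - (A + C * (ε - y * I : ℂ) ^ ((α - 1 : ℝ) : ℂ)) * cexp (I * m * (-ε + y * I)))) ?_).mono_left
      nhdsWithin_le_nhds
    have c1 : ContinuousAt (fun ε : ℝ => (ε + y * I : ℂ) ^ ((α - 1 : ℝ) : ℂ)) 0 :=
      ContinuousAt.comp (f := fun ε : ℝ => (ε + y * I : ℂ))
        (g := fun z : ℂ => z ^ ((α - 1 : ℝ) : ℂ))
        (continuousAt_cpow_const_of_re_pos (Or.inl (by simp)) hs) (by fun_prop)
    have c2 : ContinuousAt (fun ε : ℝ => (ε - y * I : ℂ) ^ ((α - 1 : ℝ) : ℂ)) 0 :=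
      ContinuousAt.comp (f := fun ε : ℝ => (ε - y * I : ℂ))
        (g := fun z : ℂ => z ^ ((α - 1 : ℝ) : ℂ))
        (continuousAt_cpow_const_of_re_pos (Or.inl (by simp)) hs) (by fun_prop)
    fun_prop

open Complex in
-- All estimates are made at `ε > 0`, where the vertical sides lie inside the strip, and the
-- inequality is then passed to the limit; no boundary values of `w` on `Re t = 0` are needed. For
-- `ε < δ` the points `ε ± iy` have norm at most `2δ`, so `hη` applies to both.
theorem norm_fourierIntegral_sub_main_term_le {w : ℂ → ℂ} {A C : ℂ} {d α δ η K : ℝ}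
    (hα : 1 < α) (hδ : 0 < δ) (hδd : δ < d)
    (hw : DifferentiableOn ℂ w {t | 0 < t.re ∧ t.re < 2 * π ∧ |t.im| < d})
    (hsym : ∀ t, w (2 * π - t) = w t)
    (hint : IntervalIntegrable (fun t : ℝ => w t) MeasureTheory.volume 0 (2 * π))
    (hK : ∀ x ∈ Set.Ioo 0 (2 * π), ‖w (x + δ * I)‖ ≤ K)
    (hη : ∀ t : ℂ, 0 < t.re → ‖t‖ ≤ 2 * δ →
      ‖w t - (A + C * t ^ ((α - 1 : ℝ) : ℂ))‖ ≤ η * ‖t‖ ^ (α - 1)) (m : ℕ) :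
    ‖(∫ x in (0 : ℝ)..(2 * π), w x * cexp (I * m * x)) -
      2 * C * (Real.cos (π / 2 * α) : ℂ) *
        (∫ y in (0 : ℝ)..δ, y ^ (α - 1) * Real.exp (-(m * y)) : ℝ)‖ ≤
      2 * π * K * Real.exp (-(δ * m))
        + 2 * η * ∫ y in (0 : ℝ)..δ, y ^ (α - 1) * Real.exp (-(m * y)) := by
  have hs : 0 < α - 1 := by linarith
  have hK0 : 0 ≤ K := (norm_nonneg _).trans (hK π ⟨Real.pi_pos, by linarith [Real.pi_pos]⟩)
  have hT1 : Filter.Tendsto (fun ε : ℝ => ∫ x in ε..(2 * π - ε), w x * cexp (I * m * x))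
      (𝓝[>] 0) (𝓝 (∫ x in (0 : ℝ)..(2 * π), w x * cexp (I * m * x))) := by
    have := tendsto_integral_shrinking_endpoints (f := fun x : ℝ => w x * cexp (I * m * x))
      Real.two_pi_pos (hint.mul_continuousOn (by fun_prop))
    simpa using this
  have hT2 := tendsto_integral_vertical_main_term A C hα hδ m
  have hcB : Continuous fun ε : ℝ => ∫ y in (0 : ℝ)..δ,
      ‖(ε + y * I : ℂ)‖ ^ (α - 1) * Real.exp (-(m * y)) := by
    refine intervalIntegral.continuous_parametric_intervalIntegral_of_continuous' ?_ 0 δ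
    refine Continuous.mul (Continuous.rpow_const (by fun_prop) fun _ => Or.inr hs.le) (by fun_prop)
  have hT3 : Filter.Tendsto (fun ε : ℝ => 2 * π * K * Real.exp (-(δ * m)) + 2 * η *
      ∫ y in (0 : ℝ)..δ, ‖(ε + y * I : ℂ)‖ ^ (α - 1) * Real.exp (-(m * y))) (𝓝[>] 0)
      (𝓝 (2 * π * K * Real.exp (-(δ * m))
        + 2 * η * ∫ y in (0 : ℝ)..δ, y ^ (α - 1) * Real.exp (-(m * y)))) := by
    refine ((hcB.tendsto' 0 _ ?_).mono_left nhdsWithin_le_nhds).const_mul _ |>.const_add _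
    refine intervalIntegral.integral_congr fun y hy => ?_
    rw [Set.uIcc_of_le hδ.le] at hy
    simp [abs_of_nonneg hy.1]
  refine le_of_tendsto_of_tendsto (hT1.sub hT2).norm hT3 ?_
  filter_upwards [Ioo_mem_nhdsGT (lt_min hδ Real.pi_pos)] with ε hε
  have hε0 : 0 < ε := hε.1
  have hεδ : ε < δ := hε.2.trans_le (min_le_left _ _)
  have hεπ : ε < π := hε.2.trans_le (min_le_right _ _)
  have hnexp : ∀ x y : ℝ, ‖cexp (I * m * (x + y * I))‖ = Real.exp (-(m * y)) := by
    intro x y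
    rw [norm_exp]
    simp
  have hdiffcont : ∀ σ : ℝ, |σ| ≤ 1 → ContinuousOn (fun y : ℝ => w (ε + σ * y * I))
      (Set.uIcc 0 δ) := by
    intro σ hσ
    refine hw.continuousOn.comp (by fun_prop) fun y hy => ?_
    rw [Set.uIcc_of_le hδ.le] at hy
    have : |σ * y| < d := by
      rw [abs_mul, abs_of_nonneg hy.1]
      nlinarith [hy.1, hy.2, abs_nonneg σ]
    refine ⟨by simpa using hε0, by simpa using by linarith, by simpa using this⟩
  rw [integral_mul_cexp_eq_contour hε0 hεπ hδ hδd hw hsym m, add_sub_assoc, ← mul_sub]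
  have cw1 : ContinuousOn (fun y : ℝ => w (ε + y * I)) (Set.uIcc 0 δ) := by
    simpa using hdiffcont 1 (by simp)
  have cw2 : ContinuousOn (fun y : ℝ => w (ε - y * I)) (Set.uIcc 0 δ) := by
    simpa [← sub_eq_add_neg] using hdiffcont (-1) (by simp)
  have c1 : Continuous fun y : ℝ => (ε + y * I : ℂ) ^ ((α - 1 : ℝ) : ℂ) :=
    Continuous.cpow (by fun_prop) continuous_const fun y => Or.inl (by simpa using hε0)
  have c2 : Continuous fun y : ℝ => (ε - y * I : ℂ) ^ ((α - 1 : ℝ) : ℂ) :=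
    Continuous.cpow (by fun_prop) continuous_const fun y => Or.inl (by simpa using hε0)
  have i1 : IntervalIntegrable (fun y : ℝ => w (ε + y * I) * cexp (I * m * (ε + y * I))
      - w (ε - y * I) * cexp (I * m * (-ε + y * I))) MeasureTheory.volume 0 δ :=
    ((cw1.mul (by fun_prop)).sub (cw2.mul (by fun_prop))).intervalIntegrable
  have i2 : IntervalIntegrable (fun y : ℝ =>
      (A + C * (ε + y * I : ℂ) ^ ((α - 1 : ℝ) : ℂ)) * cexp (I * m * (ε + y * I))
        - (A + C * (ε - y * I : ℂ) ^ ((α - 1 : ℝ) : ℂ)) * cexp (I * m * (-ε + y * I)))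
      MeasureTheory.volume 0 δ :=
    Continuous.intervalIntegrable (by fun_prop) _ _
  rw [← intervalIntegral.integral_sub i1 i2]
  refine (norm_add_le _ _).trans (add_le_add ?_ ?_)
  · refine (intervalIntegral.norm_integral_le_of_norm_le_const
      (C := K * Real.exp (-(δ * m))) fun x hx => ?_).trans ?_
    · rw [Set.uIoc_of_le (by linarith)] at hx
      rw [norm_mul, hnexp, mul_comm (m : ℝ)]
      exact mul_le_mul_of_nonneg_right (hK x ⟨by linarith [hx.1], by linarith [hx.2]⟩)
        (Real.exp_pos _).le
    · rw [abs_of_nonneg (by linarith), mul_comm, ← mul_assoc]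
      gcongr
      linarith
  · rw [norm_mul, norm_I, one_mul, ← intervalIntegral.integral_const_mul]
    have cb : Continuous fun y : ℝ => 2 * η * (‖(ε + y * I : ℂ)‖ ^ (α - 1) * Real.exp (-(m * y))) :=
      continuous_const.mul (Continuous.mul
        (Continuous.rpow_const (by fun_prop) fun _ => Or.inr hs.le) (by fun_prop))
    refine intervalIntegral.norm_integral_le_of_norm_le hδ.le
      (Filter.Eventually.of_forall fun y hy => ?_) (cb.intervalIntegrable _ _)
    have hn : ‖(ε - y * I : ℂ)‖ = ‖(ε + y * I : ℂ)‖ := by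
      rw [← norm_conj]
      simp [sub_eq_add_neg]
    have hle : ‖(ε + y * I : ℂ)‖ ≤ 2 * δ := by
      refine (norm_add_le _ _).trans ?_
      rw [norm_mul, norm_I, mul_one, norm_real, norm_real, Real.norm_of_nonneg hε0.le,
        Real.norm_of_nonneg hy.1.le]
      linarith [hy.2]
    have b1 := hη (ε + y * I) (by simpa using hε0) hle
    have b2 := hη (ε - y * I) (by simpa using hε0) (hn.trans_le hle)
    rw [hn] at b2
    have b3 := hnexp (-ε) y
    rw [ofReal_neg] at b3
    rw [sub_sub_sub_comm, ← sub_mul, ← sub_mul]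
    refine (norm_sub_le _ _).trans ?_
    rw [norm_mul, norm_mul, hnexp, b3]
    nlinarith [Real.exp_pos (-(m * y))]

open Complex in
-- Compactness handles only `[δ, 2π - δ]`; near the left end the local bound `B` applies, and near
-- the right end its reflection.
theorem exists_bound_on_horizontal_segment {w : ℂ → ℂ} {B d δ : ℝ} (hδ : 0 < δ) (hδd : δ < d)
    (hw : DifferentiableOn ℂ w {t | 0 < t.re ∧ t.re < 2 * π ∧ |t.im| < d})
    (hsym : ∀ t, w (2 * π - t) = w t)
    (hB : ∀ t : ℂ, 0 < t.re → ‖t‖ ≤ 2 * δ → ‖w t‖ ≤ B) :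
    ∃ K, ∀ x ∈ Set.Ioo 0 (2 * π), ‖w (x + δ * I)‖ ≤ K := by
  have hcont : ContinuousOn (fun x : ℝ => w (x + δ * I)) (Set.Icc δ (2 * π - δ)) := by
    refine hw.continuousOn.comp (by fun_prop) fun x hx => ?_
    refine ⟨?_, ?_, ?_⟩
    · simpa using hδ.trans_le hx.1
    · simpa using lt_of_le_of_lt hx.2 (by linarith)
    · simpa [abs_of_pos hδ] using hδd
  obtain ⟨K, hK⟩ := isCompact_Icc.exists_bound_of_continuousOn hcont
  have hnorm : ∀ x : ℝ, 0 < x → x ≤ δ → ‖(x + δ * I : ℂ)‖ ≤ 2 * δ ∧ ‖(x - δ * I : ℂ)‖ ≤ 2 * δ := by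
    intro x h1 h2
    have a1 : ‖(x : ℂ)‖ ≤ δ := by rwa [norm_real, Real.norm_of_nonneg h1.le]
    have a2 : ‖(δ * I : ℂ)‖ ≤ δ := by
      rw [norm_mul, norm_I, mul_one, norm_real, Real.norm_of_nonneg hδ.le]
    exact ⟨(norm_add_le _ _).trans (by linarith), (norm_sub_le _ _).trans (by linarith)⟩
  refine ⟨max B K, fun x hx => ?_⟩
  rcases le_or_gt x δ with h | h
  · exact (hB _ (by simpa using hx.1) (hnorm x hx.1 h).1).trans (le_max_left _ _)
  rcases le_or_gt x (2 * π - δ) with h' | h'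
  · exact (hK x ⟨h.le, h'⟩).trans (le_max_right _ _)
  · have hx' : 0 < 2 * π - x := by linarith [hx.2]
    have := hB ((2 * π - x : ℝ) - δ * I) (by simpa using hx.2)
      (hnorm _ hx' (by linarith)).2
    rw [← hsym] at this
    refine (le_of_eq ?_).trans (this.trans (le_max_left _ _))
    congr 2
    push_cast
    ring

open Complex in
theorem fourierIntegral_sub_rpow_isLittleO {w : ℂ → ℂ} {A C : ℂ} {d α : ℝ}
    (hα : 1 < α) (hd : 0 < d)
    (hw : DifferentiableOn ℂ w {t | 0 < t.re ∧ t.re < 2 * π ∧ |t.im| < d})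
    (hsym : ∀ t, w (2 * π - t) = w t)
    (hint : IntervalIntegrable (fun t : ℝ => w t) MeasureTheory.volume 0 (2 * π))
    (h0 : (fun t : ℂ => w t - (A + C * t ^ ((α - 1 : ℝ) : ℂ)))
      =o[𝓝[{t : ℂ | 0 < t.re}] 0] fun t : ℂ => ‖t‖ ^ (α - 1)) :
    (fun m : ℕ => (∫ x in (0 : ℝ)..(2 * π), w x * cexp (I * m * x)) -
      2 * C * (Real.cos (π / 2 * α) : ℂ) * (Real.Gamma α : ℂ) * (((m : ℝ) ^ (-α) : ℝ) : ℂ))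
      =o[Filter.atTop] fun m : ℕ => (m : ℝ) ^ (-α) := by
  have hΓ : 0 < Real.Gamma α := Real.Gamma_pos_of_pos (by linarith)
  have hs : 0 < α - 1 := by linarith
  rw [Asymptotics.isLittleO_iff]
  intro ε hε
  -- Half of `ε` goes to the local error `2 η Γ(α)`, half to the exponentially small terms collected
  -- in `L`.
  set η : ℝ := ε / (4 * (Real.Gamma α + 1)) with hηdef
  have hη0 : 0 < η := by positivity
  have hηε : 2 * η * Real.Gamma α ≤ ε / 2 := by
    rw [hηdef, mul_div_assoc', div_mul_eq_mul_div, div_le_iff₀ (by positivity)]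
    nlinarith
  obtain ⟨ρ, hρ, hball⟩ := Metric.eventually_nhds_iff.1
    (eventually_nhdsWithin_iff.1 ((Asymptotics.isLittleO_iff.1 h0) hη0))
  obtain ⟨δ, hδ, hδρ, hδd⟩ : ∃ δ : ℝ, 0 < δ ∧ 2 * δ < ρ ∧ δ < d := by
    refine ⟨min ρ d / 3, by positivity, ?_, ?_⟩
    · linarith [min_le_left ρ d]
    · linarith [min_le_right ρ d]
  have hη : ∀ t : ℂ, 0 < t.re → ‖t‖ ≤ 2 * δ →
      ‖w t - (A + C * t ^ ((α - 1 : ℝ) : ℂ))‖ ≤ η * ‖t‖ ^ (α - 1) := by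
    intro t h1 h2
    have := hball (y := t) (by rw [dist_zero_right]; linarith) h1
    rwa [Real.norm_of_nonneg (by positivity)] at this
  obtain ⟨K, hK⟩ := exists_bound_on_horizontal_segment
    (B := η * (2 * δ) ^ (α - 1) + (‖A‖ + ‖C‖ * (2 * δ) ^ (α - 1))) hδ hδd hw hsym (by
      intro t h1 h2
      rw [← sub_add_cancel (w t) (A + C * t ^ ((α - 1 : ℝ) : ℂ))]
      refine (norm_add_le _ _).trans (add_le_add ((hη t h1 h2).trans ?_)
        ((norm_add_le _ _).trans ?_))
      · gcongr
      · rw [norm_mul, norm_cpow_real]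
        gcongr)
  have hK0 : 0 ≤ K := (norm_nonneg _).trans (hK π ⟨Real.pi_pos, by linarith [Real.pi_pos]⟩)
  set L : ℝ := 2 * π * K + ‖2 * C * (Real.cos (π / 2 * α) : ℂ)‖ * (Real.exp δ * Real.Gamma α)
  have hL : 0 ≤ L := by positivity
  have hexp := ((isLittleO_exp_neg_mul_rpow_atTop hδ (-α)).comp_tendsto
    tendsto_natCast_atTop_atTop)
  rw [Asymptotics.isLittleO_iff] at hexp
  filter_upwards [hexp (show 0 < ε / (2 * (L + 1)) by positivity),
    Filter.eventually_ge_atTop 1] with m hm hm1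
  simp only [Function.comp, Real.norm_of_nonneg (Real.exp_pos _).le] at hm
  rw [Real.norm_of_nonneg (by positivity)] at hm ⊢
  obtain ⟨g1, g2⟩ := integral_rpow_mul_exp_neg_truncated hα hδ hm1
  have hmain := norm_fourierIntegral_sub_main_term_le hα hδ hδd hw hsym hint hK hη m
  set G : ℝ := ∫ y in (0 : ℝ)..δ, y ^ (α - 1) * Real.exp (-(m * y))
  have hsecond : ‖2 * C * (Real.cos (π / 2 * α) : ℂ) * (G : ℂ) -
      2 * C * (Real.cos (π / 2 * α) : ℂ) * (Real.Gamma α : ℂ) * (((m : ℝ) ^ (-α) : ℝ) : ℂ)‖ ≤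
      ‖2 * C * (Real.cos (π / 2 * α) : ℂ)‖ * (Real.exp δ * Real.Gamma α * Real.exp (-(δ * m))) := by
    rw [mul_assoc _ (Real.Gamma α : ℂ), ← mul_sub, norm_mul, ← ofReal_mul, ← ofReal_sub, norm_real,
      norm_sub_rev, Real.norm_of_nonneg g1]
    gcongr
  have hE : L * Real.exp (-(δ * m)) ≤ ε / 2 * (m : ℝ) ^ (-α) := by
    rw [neg_mul] at hm
    calc L * Real.exp (-(δ * m)) ≤ (L + 1) * (ε / (2 * (L + 1)) * (m : ℝ) ^ (-α)) := by
          gcongr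
          linarith
      _ = ε / 2 * (m : ℝ) ^ (-α) := by field_simp
  have hG : 2 * η * G ≤ ε / 2 * (m : ℝ) ^ (-α) := by
    calc 2 * η * G ≤ 2 * η * (Real.Gamma α * (m : ℝ) ^ (-α)) := by
          gcongr
          linarith
      _ = (2 * η * Real.Gamma α) * (m : ℝ) ^ (-α) := by ring
      _ ≤ _ := by gcongr
  refine (norm_sub_le_norm_sub_add_norm_sub _ _ _).trans ((add_le_add hmain hsecond).trans ?_)
  have : L * Real.exp (-(δ * m)) = 2 * π * K * Real.exp (-(δ * m)) +
    ‖2 * C * (Real.cos (π / 2 * α) : ℂ)‖ * (Real.exp δ * Real.Gamma α * Real.exp (-(δ * m))) := by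
    ring
  linarith

/-! ### The parametrisation `t ↦ e^{it}` and one-sided boundary values. -/

open Complex in
-- The exponential is a positive real only when `t.re` is a multiple of `2π`, which the open strip
-- excludes.
theorem mapsTo_cexp_I_mul_cutAnnulus {r : ℝ} (hr : 1 < r) {t : ℂ} (h0 : 0 < t.re)
    (h1 : t.re < 2 * π) (h2 : |t.im| < Real.log r) : cexp (I * t) ∈ cutAnnulus r := by
  have hr0 : 0 < r := by linarith
  have hn : ‖cexp (I * t)‖ = Real.exp (-t.im) := by rw [norm_exp]; simp
  obtain ⟨h3, h4⟩ := abs_lt.1 h2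
  refine ⟨⟨?_, ?_⟩, ?_⟩
  · rw [hn, ← Real.exp_log (inv_pos.2 hr0), Real.log_inv]
    exact Real.exp_le_exp.2 (by linarith)
  · rw [hn]
    exact (Real.exp_le_exp.2 (by linarith)).trans_eq (Real.exp_log hr0)
  · rintro ⟨x, hx, hxe⟩
    have hx0 : 0 < x := (inv_pos.2 hr0).trans_le hx.1
    simp only at hxe
    have him := congrArg Complex.im hxe
    have hre := congrArg Complex.re hxe
    rw [exp_im] at him
    rw [exp_re] at hre
    simp only [ofReal_re, ofReal_im, mul_re, mul_im, I_re, I_im, zero_mul, one_mul, zero_sub,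
      zero_add] at him hre
    have hsin : Real.sin t.re = 0 := by
      rcases mul_eq_zero.1 him.symm with h | h
      · exact absurd h (Real.exp_pos _).ne'
      · exact h
    have hcos : 0 < Real.cos t.re := by
      by_contra hc
      nlinarith [Real.exp_pos (-t.im)]
    have hcos1 : Real.cos t.re = 1 := by
      nlinarith [Real.sin_sq_add_cos_sq t.re]
    obtain ⟨k, hk⟩ := (Real.cos_eq_one_iff _).1 hcos1
    rw [← hk] at h0 h1
    have hk0 : (0 : ℝ) < k := pos_of_mul_pos_left h0 (by positivity)
    have hk1 : (k : ℝ) < 1 := by nlinarith [Real.pi_pos]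
    norm_cast at hk0 hk1
    omega

/-- A function with limits at both ends of an open interval agrees there with a function continuous
on the closed interval. -/
theorem exists_continuousOn_Icc_extension {f : ℝ → ℂ} {a b : ℝ} {la lb : ℂ} (hab : a < b)
    (hf : ContinuousOn f (Set.Ioo a b)) (ha : Filter.Tendsto f (𝓝[>] a) (𝓝 la))
    (hb : Filter.Tendsto f (𝓝[<] b) (𝓝 lb)) :
    ∃ F : ℝ → ℂ, ContinuousOn F (Set.Icc a b) ∧ Set.EqOn F f (Set.Ioo a b) ∧
      F a = la ∧ F b = lb :=
  ⟨extendFrom (Set.Ioo a b) f, continuousOn_Icc_extendFrom_Ioo hf ha hb,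
    extendFrom_extends hf,
    eq_lim_at_left_extendFrom_Ioo hab ha, eq_lim_at_right_extendFrom_Ioo hab hb⟩

theorem tendsto_of_sub_add_cpow_isLittleO {v : ℂ → ℂ} {l : Filter ℂ} {A C : ℂ} {α : ℝ}
    (hα : 1 < α) {s : ℂ → ℂ} (hs : Filter.Tendsto s l (𝓝 0))
    (h : (fun t => v t - (A + C * s t ^ ((α - 1 : ℝ) : ℂ))) =o[l] fun t => ‖s t‖ ^ (α - 1)) :
    Filter.Tendsto v l (𝓝 A) := by
  have h1 : Filter.Tendsto (fun t => ‖s t‖ ^ (α - 1)) l (𝓝 0) := by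
    have := hs.norm.rpow_const (p := α - 1) (Or.inr (by linarith))
    rwa [norm_zero, Real.zero_rpow (by linarith)] at this
  have h2 : Filter.Tendsto (fun t => s t ^ ((α - 1 : ℝ) : ℂ)) l (𝓝 0) := by
    rw [tendsto_zero_iff_norm_tendsto_zero]
    simpa only [Complex.norm_cpow_real] using h1
  have h3 := (h.trans_tendsto h1).add ((h2.const_mul C).const_add A)
  simpa using h3

/-! ### Symmetrisation and conclusion. -/

theorem mainTheorem2 (u : ℂ → ℂ) (r α : ℝ) (uStart uEnd C₃ C₄ : ℂ)
    (hr : 1 < r) (hα : 1 < α)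
    (hu : AnalyticOnNhd ℂ u (cutAnnulus r))
    (hStart : (fun t : ℂ => u (Complex.exp (Complex.I * t))
          - (uStart + C₃ * t ^ ((α - 1 : ℝ) : ℂ)))
        =o[𝓝[{t : ℂ | 0 < t.re}] 0] (fun t : ℂ => ‖t‖ ^ (α - 1)))
    (hEnd : (fun t : ℂ => u (Complex.exp (Complex.I * t))
          - (uEnd + C₄ * (2 * (π : ℂ) - t) ^ ((α - 1 : ℝ) : ℂ)))
        =o[𝓝[{t : ℂ | t.re < 2 * π}] (2 * (π : ℂ))]
          (fun t : ℂ => ‖2 * (π : ℂ) - t‖ ^ (α - 1))) :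
    IntervalIntegrable (fun t : ℝ => u (Complex.exp (Complex.I * (t : ℂ))))
        MeasureTheory.volume 0 (2 * π) ∧
    (fun n : ℕ => trapezoidalRule u uStart uEnd n - circleIntegralI u
          - 2 * (C₃ + C₄) * (Real.cos (π / 2 * α) : ℂ) * (Real.Gamma α : ℂ)
              * riemannZeta (α : ℂ) * (((n : ℝ) ^ (-α) : ℝ) : ℂ))
        =o[Filter.atTop] (fun n : ℕ => (n : ℝ) ^ (-α)) := by
  have h2π := Real.two_pi_pos
  set v : ℂ → ℂ := fun t => u (Complex.exp (Complex.I * t)) with hvdef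
  have hd : 0 < Real.log r := Real.log_pos hr
  have hv : DifferentiableOn ℂ v {t | 0 < t.re ∧ t.re < 2 * π ∧ |t.im| < Real.log r} :=
    hu.differentiableOn.comp (by fun_prop)
      fun t ht => mapsTo_cexp_I_mul_cutAnnulus hr ht.1 ht.2.1 ht.2.2
  have hvr : ContinuousOn (fun t : ℝ => v t) (Set.Ioo 0 (2 * π)) :=
    hv.continuousOn.comp (by fun_prop) fun t ht => by simpa [hd] using ht
  have hv0 : Filter.Tendsto (fun t : ℝ => v t) (𝓝[>] 0) (𝓝 uStart) := by
    refine (tendsto_of_sub_add_cpow_isLittleO hα (s := fun t => t)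
      (Filter.tendsto_id.mono_left nhdsWithin_le_nhds) hStart).comp ?_
    refine tendsto_nhdsWithin_iff.2 ⟨?_, ?_⟩
    · exact (Complex.continuous_ofReal.tendsto' 0 0 (by simp)).mono_left nhdsWithin_le_nhds
    · filter_upwards [self_mem_nhdsWithin] with t ht using by simpa using ht
  have hv1 : Filter.Tendsto (fun t : ℝ => v t) (𝓝[<] (2 * π)) (𝓝 uEnd) := by
    refine (tendsto_of_sub_add_cpow_isLittleO hα (s := fun t => 2 * (π : ℂ) - t)
      (((continuous_const.sub continuous_id).tendsto' _ _ (by simp)).mono_left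
        nhdsWithin_le_nhds) hEnd).comp ?_
    refine tendsto_nhdsWithin_iff.2 ⟨?_, ?_⟩
    · exact (Complex.continuous_ofReal.tendsto' _ _ (by simp)).mono_left nhdsWithin_le_nhds
    · filter_upwards [self_mem_nhdsWithin] with t ht using by simpa using ht
  -- At both ends `v` takes the value `u 1`, which is unrelated to `uStart` and `uEnd`; `V` carries
  -- the one-sided limits instead.
  obtain ⟨V, hVc, hVv, hV0, hV1⟩ := exists_continuousOn_Icc_extension h2π hvr hv0 hv1
  have hVi : IntervalIntegrable V MeasureTheory.volume 0 (2 * π) :=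
    ContinuousOn.intervalIntegrable (by rwa [Set.uIcc_of_le h2π.le])
  have hvi : IntervalIntegrable (fun t : ℝ => v t) MeasureTheory.volume 0 (2 * π) := by
    rw [intervalIntegrable_iff_integrableOn_Ioo_of_le h2π.le] at hVi ⊢
    exact hVi.congr_fun hVv measurableSet_Ioo
  refine ⟨hvi, ?_⟩
  -- `w` is the holomorphic version for the contour argument, `W` the continuous one for Fourier
  -- series; they agree on the open interval.
  set w : ℂ → ℂ := fun t => v t + v (2 * π - t) with hwdef
  set W : ℝ → ℂ := fun t => V t + V (2 * π - t) with hWdef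
  have hsymw : ∀ t, w (2 * π - t) = w t := fun t => by
    simp only [hwdef, sub_sub_cancel]
    exact add_comm _ _
  have hsymW : ∀ t ∈ Set.Icc 0 (2 * π), W (2 * π - t) = W t := fun t _ => by
    simp only [hWdef, sub_sub_cancel]
    exact add_comm _ _
  have hw : DifferentiableOn ℂ w {t | 0 < t.re ∧ t.re < 2 * π ∧ |t.im| < Real.log r} := by
    refine hv.add (hv.comp (by fun_prop) fun t ht => ?_)
    obtain ⟨h1, h2, h3⟩ := ht
    refine ⟨?_, ?_, ?_⟩
    · simpa using h2
    · simpa using h1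
    · simpa using h3
  have hVci : ContinuousOn (fun t => V (2 * π - t)) (Set.Icc 0 (2 * π)) :=
    hVc.comp (by fun_prop) fun t ht => ⟨by linarith [ht.2], by linarith [ht.1]⟩
  have hWc : ContinuousOn W (Set.Icc 0 (2 * π)) := hVc.add hVci
  have hWw : ∀ t ∈ Set.Ioo 0 (2 * π), W t = w t := fun t ht => by
    have h1 := hVv (x := 2 * π - t) ⟨by linarith [ht.2], by linarith [ht.1]⟩
    simp only [hWdef, hwdef]
    rw [hVv ht, h1]
    push_cast
    rfl
  have hwi : IntervalIntegrable (fun t : ℝ => w t) MeasureTheory.volume 0 (2 * π) := by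
    have hWi : IntervalIntegrable W MeasureTheory.volume 0 (2 * π) :=
      ContinuousOn.intervalIntegrable (by rwa [Set.uIcc_of_le h2π.le])
    rw [intervalIntegrable_iff_integrableOn_Ioo_of_le h2π.le] at hWi ⊢
    exact hWi.congr_fun hWw measurableSet_Ioo
  have hw0 : (fun t : ℂ => w t - (uStart + uEnd + (C₃ + C₄) * t ^ ((α - 1 : ℝ) : ℂ)))
      =o[𝓝[{t : ℂ | 0 < t.re}] 0] fun t : ℂ => ‖t‖ ^ (α - 1) := by
    have hrefl : Filter.Tendsto (fun t : ℂ => 2 * (π : ℂ) - t) (𝓝[{t : ℂ | 0 < t.re}] 0)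
        (𝓝[{t : ℂ | t.re < 2 * π}] (2 * (π : ℂ))) := by
      refine tendsto_nhdsWithin_iff.2 ⟨?_, ?_⟩
      · exact ((continuous_const.sub continuous_id).tendsto' _ _ (by simp)).mono_left
          nhdsWithin_le_nhds
      · filter_upwards [self_mem_nhdsWithin] with t ht using by simpa using ht
    have h := hEnd.comp_tendsto hrefl
    simp only [Function.comp_def, sub_sub_cancel] at h
    refine (hStart.add h).congr_left fun t => ?_
    simp only [hwdef, hvdef]
    ring
  have hcoef := fourierIntegral_sub_rpow_isLittleO hα hd hw hsymw hwi hw0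
  have hcW : ∀ m : ℕ, ∫ t in (0 : ℝ)..(2 * π), W t * Complex.exp (Complex.I * m * t) =
      ∫ t in (0 : ℝ)..(2 * π), w t * Complex.exp (Complex.I * m * t) := fun m =>
    intervalIntegral.integral_congr_Ioo_of_le h2π.le fun t ht => by
      rw [hWw t ht]
  have hsum := summable_of_sub_rpow_isLittleO hα hcoef
  have hlim := tsum_multiples_sub_zeta_isLittleO hα hcoef
  have hIW : ∫ t in (0 : ℝ)..(2 * π), W t = 2 * circleIntegralI u := by
    have h1 := intervalIntegral.integral_comp_sub_left V (a := 0) (b := 2 * π) (2 * π)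
    rw [sub_self, sub_zero] at h1
    have h2 : ∫ t in (0 : ℝ)..(2 * π), V t = circleIntegralI u :=
      intervalIntegral.integral_congr_Ioo_of_le h2π.le hVv
    have hVi' : IntervalIntegrable (fun t => V (2 * π - t)) MeasureTheory.volume 0 (2 * π) :=
      ContinuousOn.intervalIntegrable (by rwa [Set.uIcc_of_le h2π.le])
    simp only [hWdef]
    rw [intervalIntegral.integral_add hVi hVi', h1, h2, two_mul]
  have hTW : ∀ n : ℕ, 0 < n → (2 * π / n : ℂ) * ∑ k ∈ Finset.range n, W (2 * π * k / n) =
      2 * trapezoidalRule u uStart uEnd n := by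
    intro n hn
    have hnR : (0 : ℝ) < n := by exact_mod_cast hn
    have hVk : ∀ k ∈ Finset.Ico 1 n, V (2 * π * k / n) =
        u (Complex.exp (2 * (π : ℂ) * Complex.I * (k : ℂ) / (n : ℂ))) := by
      intro k hk
      rw [Finset.mem_Ico] at hk
      have hk0 : (0 : ℝ) < k := by exact_mod_cast hk.1
      have hkn : (k : ℝ) < n := by exact_mod_cast hk.2
      rw [hVv ⟨by positivity, by rw [div_lt_iff₀ hnR]; exact mul_lt_mul_of_pos_left hkn h2π⟩]
      simp only [hvdef]
      congr 2
      push_cast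
      ring
    have hrefl : ∑ k ∈ Finset.Ico 1 n, V (2 * π - 2 * π * k / n) =
        ∑ k ∈ Finset.Ico 1 n, V (2 * π * k / n) := by
      have := Finset.sum_Ico_reflect (fun k : ℕ => V (2 * π * k / n)) 1 (Nat.le_succ n)
      simp only [Nat.add_sub_cancel, Nat.add_sub_cancel_left] at this
      rw [← this]
      refine Finset.sum_congr rfl fun k hk => ?_
      rw [Nat.cast_sub (Finset.mem_Ico.1 hk).2.le]
      congr 1
      field_simp
    -- The node `k = 0` contributes `W 0 = uStart + uEnd`, which is twice the two halved end terms.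
    rw [Finset.range_eq_Ico, Finset.sum_eq_sum_Ico_succ_bot hn, zero_add]
    simp only [hWdef, Finset.sum_add_distrib, hrefl, Nat.cast_zero, mul_zero, zero_div, sub_zero,
      hV0, hV1]
    rw [Finset.sum_congr rfl hVk, trapezoidalRule]
    ring
  refine hlim.congr' ?_ Filter.EventuallyEq.rfl
  filter_upwards [Filter.eventually_gt_atTop 0] with n hn
  have hal := hasSum_trapezoidal_aliasing hWc hsymW (by simpa only [hcW] using hsum) hn
  -- The factor `2` from symmetrisation cancels the one from pairing the frequencies `±m`.
  rw [hTW n hn, hIW, ← mul_sub] at hal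
  have := hal.tsum_eq
  rw [tsum_mul_left] at this
  simp only [hcW] at this
  rw [mul_left_cancel₀ two_ne_zero this]
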